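/- Let $\mathbb{K}$ be a field and let $(\mathcal{C},\mathbb{E},\mathfrak{s})$ be a $\mathbb{K}$-linear extriangulated category in the sense of Nakaoka and Palu. It is called Frobenius if it has enough projectives and enough injectives and its projective and injective objects coincide; then $\mathcal{P}$ denotes the full subcategory of projective-injective objects, and the stable category $\underline{\mathcal{C}}=\mathcal{C}/(\mathcal{P})$ has a suspension functor $\Sigma$, with $\Sigma X$ the third term of a conflation $X\rightarrowtail I\twoheadrightarrow \Sigma X$ with $I$ injective. A Frobenius extriangulated category $\mathcal{C}$ is called stably 2-Calabi–Yau if all spaces $\operatorname{Hom}_{\underline{\mathcal{C}}}(X,Y)$ are finite-dimensional over $\mathbb{K}$ and, writing $\operatorname{Ext}^1_{\underline{\mathcal{C}}}(X,Y)=\operatorname{Hom}_{\underline{\mathcal{C}}}(X,\Sigma Y)$ and $\mathrm{D}=\operatorname{Hom}_{\mathbb{K}}(-,\mathbb{K})$, there are $\mathbb{K}$-linear isomorphisms $\operatorname{Ext}^1_{\underline{\mathcal{C}}}(X,Y)\cong \mathrm{D}\operatorname{Ext}^1_{\underline{\mathcal{C}}}(Y,X)$ natural in $X$ and $Y$. Subcategories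 are full. For a subcategory $\mathcal{X}\subseteq\mathcal{C}$ write $\mathcal{X}^{\perp_1}=\{Y:\mathbb{E}(X,Y)=0 \text{ for all } X\in\mathcal{X}\}$ and ${}^{\perp_1}\mathcal{X}=\{Y:\mathbb{E}(Y,X)=0 \text{ for all } X\in\mathcal{X}\}$. Call $\mathcal{X}$ rigid if $\mathcal{X}\subseteq{}^{\perp_1}\mathcal{X}$, and functorially finite if every object of $\mathcal{C}$ has a right and a left $\mathcal{X}$-approximation. Call $\mathcal{T}\subseteq\mathcal{C}$ cluster-tilting if it is functorially finite and ${}^{\perp_1}\mathcal{T}=\mathcal{T}=\mathcal{T}^{\perp_1}$. Theorem. Let $\mathcal{C}$ be a stably 2-Calabi–Yau Frobenius extriangulated category and let $\mathcal{X}\subseteq\mathcal{C}$ be a rigid, functorially finite subcategory. Then: (1) $\mathcal{X}^{\perp_1}$, with the restrictions of $\mathbb{E}$ and $\mathfrak{s}$, is again a stably 2-Calabi–Yau Frobenius extriangulated category. (2) $\mathcal{X}^{\perp_1}$ is functorially finite in $\mathcal{C}$. (3) The projective-injective objects of $\mathcal{X}^{\perp_1}$ are precisely the objects of $\operatorname{add}(\mathcal{X},\mathcal{P})$,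 the smallest full subcategory of $\mathcal{C}$ containing $\mathcal{X}$ and $\mathcal{P}$ and closed under finite direct sums and direct summands. (4) If $\mathcal{C}$ is weakly idempotent complete (every retraction has a kernel), then so is $\mathcal{X}^{\perp_1}$. (5) The cluster-tilting subcategories of $\mathcal{X}^{\perp_1}$ are precisely the cluster-tilting subcategories $\mathcal{T}$ of $\mathcal{C}$ with $\mathcal{X}\subseteq\mathcal{T}$. -/

import Mathlib

open CategoryTheory CategoryTheory.Limits Opposite

universe w v u k

namespace Extri

/-! ## Subcategories of an additive category

A full subcategory is given by the property `P : ObjectProperty C` of belonging to it. -/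

section Subcategories

variable {C : Type u} [Category.{v} C]

/-- `f : X ⟶ A` is a right `P`-approximation of `A`. -/
def IsRightApprox (P : ObjectProperty C) {X A : C} (f : X ⟶ A) : Prop :=
  P X ∧ ∀ ⦃X' : C⦄, P X' → ∀ g : X' ⟶ A, ∃ h : X' ⟶ X, h ≫ f = g

/-- `f : A ⟶ X` is a left `P`-approximation of `A`. -/
def IsLeftApprox (P : ObjectProperty C) {A X : C} (f : A ⟶ X) : Prop :=
  P X ∧ ∀ ⦃X' : C⦄, P X' → ∀ g : A ⟶ X', ∃ h : X ⟶ X', f ≫ h = g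

/-- Functorially finite: contravariantly finite and covariantly finite. -/
def FunctoriallyFinite (P : ObjectProperty C) : Prop :=
  (∀ A : C, ∃ (X : C) (f : X ⟶ A), IsRightApprox P f) ∧
    (∀ A : C, ∃ (X : C) (f : A ⟶ X), IsLeftApprox P f)

variable [Preadditive C]

/-- `add P`: the smallest full subcategory containing `P` and closed under finite direct sums
(including the empty one) and direct summands. -/
inductive AddClosure (P : ObjectProperty C) : ObjectProperty C
  | of {X : C} (h : P X) : AddClosure P X
  | zero {X : C} (h : IsZero X) : AddClosure P X
  | sum {X Y : C} (b : BinaryBicone X Y) (hb : Nonempty b.IsBilimit)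
      (hX : AddClosure P X) (hY : AddClosure P Y) : AddClosure P b.pt
  | summand {X Y : C} (b : BinaryBicone X Y) (hb : Nonempty b.IsBilimit)
      (h : AddClosure P b.pt) : AddClosure P X

/-- Weak idempotent completeness: every retraction has a kernel. -/
def WeaklyIdempotentComplete (C : Type u) [Category.{v} C] [Preadditive C] : Prop :=
  ∀ ⦃X Y : C⦄ (f : X ⟶ Y), IsSplitEpi f → HasKernel f

end Subcategories

/-! ## The quotient of a linear category by the ideal generated by a class of objects -/

section IdealQuotient

variable (K : Type k) [Field K] {C : Type u} [Category.{v} C] [Preadditive C] [Linear K C]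

/-- The ideal `(P)`: linear combinations of morphisms factoring through an object of `P`. -/
def objIdeal (P : ObjectProperty C) (X Y : C) : Submodule K (X ⟶ Y) :=
  Submodule.span K {f | ∃ (Z : C) (_ : P Z) (a : X ⟶ Z) (b : Z ⟶ Y), f = a ≫ b}

variable {K} in
lemma objIdeal_comp_left {P : ObjectProperty C} {X Y Z : C} (f : X ⟶ Y) {g : Y ⟶ Z}
    (hg : g ∈ objIdeal K P Y Z) : f ≫ g ∈ objIdeal K P X Z := by
  refine Submodule.span_induction (p := fun g _ => f ≫ g ∈ objIdeal K P X Z)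
    ?_ ?_ ?_ ?_ hg
  · rintro _ ⟨W, hW, a, b, rfl⟩
    exact Submodule.subset_span ⟨W, hW, f ≫ a, b, by simp⟩
  · simp
  · intro x y _ _ hx hy
    simpa using add_mem hx hy
  · intro r x _ hx
    simpa using Submodule.smul_mem _ r hx

variable {K} in
lemma objIdeal_comp_right {P : ObjectProperty C} {X Y Z : C} {f : X ⟶ Y} (g : Y ⟶ Z)
    (hf : f ∈ objIdeal K P X Y) : f ≫ g ∈ objIdeal K P X Z := by
  refine Submodule.span_induction (p := fun f _ => f ≫ g ∈ objIdeal K P X Z)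
    ?_ ?_ ?_ ?_ hf
  · rintro _ ⟨W, hW, a, b, rfl⟩
    exact Submodule.subset_span ⟨W, hW, a, b ≫ g, by simp⟩
  · simp
  · intro x y _ _ hx hy
    simpa using add_mem hx hy
  · intro r x _ hx
    simpa using Submodule.smul_mem _ r hx

/-- Congruence modulo the ideal `(P)`. -/
def idealRel (P : ObjectProperty C) : HomRel C :=
  fun X Y f g => f - g ∈ objIdeal K P X Y

instance idealRel_congruence (P : ObjectProperty C) : Congruence (idealRel K P) where
  comp_left f _ _ h := by
    simpa [idealRel] using objIdeal_comp_left f h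
  comp_right g h := by
    simpa [idealRel] using objIdeal_comp_right g h
  equivalence :=
    { refl := fun f => by simp [idealRel]
      symm := fun {f g} h => by
        have := neg_mem h
        rwa [neg_sub] at this
      trans := fun {f g e} h h' => by
        have := add_mem h h'
        rwa [sub_add_sub_cancel] at this }

lemma idealRel_add (P : ObjectProperty C) ⦃X Y : C⦄ (f₁ f₂ g₁ g₂ : X ⟶ Y)
    (hf : idealRel K P f₁ f₂) (hg : idealRel K P g₁ g₂) :
    idealRel K P (f₁ + g₁) (f₂ + g₂) := by
  have := add_mem hf hg
  rwa [← add_sub_add_comm] at this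

lemma idealRel_smul (P : ObjectProperty C) (a : K) ⦃X Y : C⦄ (f₁ f₂ : X ⟶ Y)
    (hf : idealRel K P f₁ f₂) : idealRel K P (a • f₁) (a • f₂) := by
  have := Submodule.smul_mem _ a hf
  rwa [smul_sub] at this

/-- The quotient category `C / (P)`. -/
abbrev IdealQuotient (P : ObjectProperty C) := Quotient (idealRel K P)

instance (P : ObjectProperty C) : Preadditive (IdealQuotient K P) :=
  Quotient.preadditive _ (idealRel_add K P)

instance (P : ObjectProperty C) : (Quotient.functor (idealRel K P)).Additive :=
  Quotient.functor_additive _ (idealRel_add K P)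

instance (P : ObjectProperty C) : Linear K (IdealQuotient K P) :=
  Quotient.linear K _ (idealRel_smul K P)

end IdealQuotient

/-! ## The 2-Calabi–Yau property

`T` is a `K`-linear category with a suspension functor `sh`, and
`Ext¹(X, Y) = Hom(X, sh Y)`. -/

/-- `T` is Hom-finite, and there are `K`-linear isomorphisms `Ext¹(X, Y) ≅ D Ext¹(Y, X)`
which are natural in `X` and `Y`, where `D = Hom_K(-, K)`. -/
def IsTwoCalabiYau (K : Type k) [Field K] (T : Type u) [Category.{v} T] [Preadditive T]
    [Linear K T] (sh : T ⥤ T) : Prop :=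
  (∀ X Y : T, FiniteDimensional K (X ⟶ Y)) ∧
  ∃ φ : ∀ X Y : T, (X ⟶ sh.obj Y) ≃ₗ[K] Module.Dual K (Y ⟶ sh.obj X),
    ∀ ⦃X X' Y Y' : T⦄ (f : X' ⟶ X) (g : Y ⟶ Y') (a : X ⟶ sh.obj Y) (b : Y' ⟶ sh.obj X'),
      φ X' Y' (f ≫ a ≫ sh.map g) b = φ X Y a (g ≫ b ≫ sh.map f)

/-! ## Extriangulated categories -/

/-- The data of a `K`-linear extriangulated category on `C`: a bifunctor `𝔼` to `K`-modules and
a relation `Realizes f g δ`, saying that the sequence `A ⟶ B ⟶ X` given by `(f, g)` belongs to the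
class `𝔰(δ)`, for `δ ∈ 𝔼(X, A)`. The axioms are in `IsExtriangulated`. -/
structure ExtriData (K : Type k) [Field K] (C : Type u) [Category.{v} C] where
  /-- the bifunctor `𝔼` -/
  bifun : Cᵒᵖ ⥤ C ⥤ ModuleCat.{w} K
  /-- the realisation -/
  Realizes : ∀ {A B X : C}, (A ⟶ B) → (B ⟶ X) → (bifun.obj (op X)).obj A → Prop

namespace ExtriData

section Basic

variable {K : Type k} [Field K] {C : Type u} [Category.{v} C] (S : ExtriData.{w} K C)

/-- The `K`-module `𝔼(X, A)`. -/
abbrev Ext (X A : C) : Type w := (S.bifun.obj (op X)).obj A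

/-- `a_* : 𝔼(X, A) → 𝔼(X, A')`. -/
def push {X A A' : C} (a : A ⟶ A') : S.Ext X A →ₗ[K] S.Ext X A' :=
  ((S.bifun.obj (op X)).map a).hom

/-- `c^* : 𝔼(X, A) → 𝔼(X', A)`. -/
def pull {X X' A : C} (c : X' ⟶ X) : S.Ext X A →ₗ[K] S.Ext X' A :=
  ((S.bifun.map c.op).app A).hom

variable {S} in
lemma push_comp_apply {X A A' A'' : C} (a : A ⟶ A') (a' : A' ⟶ A'') (δ : S.Ext X A) :
    S.push (a ≫ a') δ = S.push a' (S.push a δ) := by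
  simp [push]

variable {S} in
lemma push_id_apply {X A : C} (δ : S.Ext X A) : S.push (𝟙 A) δ = δ := by
  simp [push]

variable {S} in
lemma pull_comp_apply {X X' X'' A : C} (c : X' ⟶ X) (c' : X'' ⟶ X') (δ : S.Ext X A) :
    S.pull (c' ≫ c) δ = S.pull c' (S.pull c δ) := by
  simp [pull]

variable {S} in
lemma pull_id_apply {X A : C} (δ : S.Ext X A) : S.pull (𝟙 X) δ = δ := by
  simp [pull]

variable {S} in
lemma push_pull_apply {X X' A A' : C} (a : A ⟶ A') (c : X' ⟶ X) (δ : S.Ext X A) :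
    S.push a (S.pull c δ) = S.pull c (S.push a δ) := by
  have := congrArg (fun t => t.hom δ) ((S.bifun.map c.op).naturality a)
  exact this.symm

/-- `f` is an inflation. -/
def Inflation {A B : C} (f : A ⟶ B) : Prop :=
  ∃ (X : C) (g : B ⟶ X) (δ : S.Ext X A), S.Realizes f g δ

/-- `g` is a deflation. -/
def Deflation {B X : C} (g : B ⟶ X) : Prop :=
  ∃ (A : C) (f : A ⟶ B) (δ : S.Ext X A), S.Realizes f g δ

/-- Projective objects. -/
def IsProj : ObjectProperty C := fun P =>
  ∀ ⦃B X : C⦄ (g : B ⟶ X), S.Deflation g → ∀ h : P ⟶ X, ∃ t : P ⟶ B, t ≫ g = h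

/-- Injective objects. -/
def IsInj : ObjectProperty C := fun I =>
  ∀ ⦃A B : C⦄ (f : A ⟶ B), S.Inflation f → ∀ h : A ⟶ I, ∃ t : B ⟶ I, f ≫ t = h

/-- Projective-injective objects. -/
def IsProjInj : ObjectProperty C := fun P => S.IsProj P ∧ S.IsInj P

/-- `𝒳^{⊥₁} = {Y | 𝔼(X, Y) = 0 for all X ∈ 𝒳}`. -/
def rightPerp (𝒳 : ObjectProperty C) : ObjectProperty C := fun Y =>
  ∀ ⦃X : C⦄, 𝒳 X → ∀ δ : S.Ext X Y, δ = 0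

/-- `^{⊥₁}𝒳 = {Y | 𝔼(Y, X) = 0 for all X ∈ 𝒳}`. -/
def leftPerp (𝒳 : ObjectProperty C) : ObjectProperty C := fun Y =>
  ∀ ⦃X : C⦄, 𝒳 X → ∀ δ : S.Ext Y X, δ = 0

/-- Rigid subcategories. -/
def IsRigid (𝒳 : ObjectProperty C) : Prop := 𝒳 ≤ S.leftPerp 𝒳

/-- Cluster-tilting subcategories. -/
def IsClusterTilting (𝒯 : ObjectProperty C) : Prop :=
  S.leftPerp 𝒯 = 𝒯 ∧ 𝒯 = S.rightPerp 𝒯 ∧ FunctoriallyFinite 𝒯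

/-- The restriction of `𝔼` and `𝔰` to a full subcategory. -/
def restrict (𝒟 : ObjectProperty C) : ExtriData.{w} K 𝒟.FullSubcategory where
  bifun := 𝒟.ι.op ⋙ S.bifun ⋙ (Functor.whiskeringLeft _ _ _).obj 𝒟.ι
  Realizes {A B X} f g δ := S.Realizes (A := A.obj) (B := B.obj) (X := X.obj) f.hom g.hom δ

end Basic

variable {K : Type k} [Field K] {C : Type u} [Category.{v} C] [Preadditive C] [Linear K C]
  (S : ExtriData.{w} K C)

/-- The axioms of a `K`-linear extriangulated category, after Nakaoka and Palu. -/
structure IsExtriangulated : Prop where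
  /-- `C` is additive -/
  hasZeroObject : HasZeroObject C
  hasBinaryBiproducts : HasBinaryBiproducts C
  /-- (ET1) `𝔼` is `K`-bilinear -/
  push_add : ∀ ⦃X A A' : C⦄ (a a' : A ⟶ A') (δ : S.Ext X A),
    S.push (a + a') δ = S.push a δ + S.push a' δ
  push_smul : ∀ ⦃X A A' : C⦄ (r : K) (a : A ⟶ A') (δ : S.Ext X A),
    S.push (r • a) δ = r • S.push a δ
  pull_add : ∀ ⦃X X' A : C⦄ (c c' : X' ⟶ X) (δ : S.Ext X A),
    S.pull (c + c') δ = S.pull c δ + S.pull c' δ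
  pull_smul : ∀ ⦃X X' A : C⦄ (r : K) (c : X' ⟶ X) (δ : S.Ext X A),
    S.pull (r • c) δ = r • S.pull c δ
  /-- `𝔰(δ)` is an equivalence class of sequences with zero composite: it is non-empty, any two
  members are equivalent, and it is closed under equivalence -/
  exists_realizes : ∀ ⦃X A : C⦄ (δ : S.Ext X A),
    ∃ (B : C) (f : A ⟶ B) (g : B ⟶ X), S.Realizes f g δ
  comp_zero : ∀ ⦃A B X : C⦄ (f : A ⟶ B) (g : B ⟶ X) (δ : S.Ext X A),
    S.Realizes f g δ → f ≫ g = 0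
  realizes_unique : ∀ ⦃A B B' X : C⦄ (f : A ⟶ B) (g : B ⟶ X) (f' : A ⟶ B') (g' : B' ⟶ X)
    (δ : S.Ext X A), S.Realizes f g δ → S.Realizes f' g' δ →
      ∃ e : B ≅ B', f ≫ e.hom = f' ∧ e.hom ≫ g' = g
  realizes_iso : ∀ ⦃A B B' X : C⦄ (f : A ⟶ B) (g : B ⟶ X) (f' : A ⟶ B') (g' : B' ⟶ X)
    (δ : S.Ext X A) (e : B ≅ B'), f ≫ e.hom = f' → e.hom ≫ g' = g →
      S.Realizes f g δ → S.Realizes f' g' δ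
  /-- (ET2) `𝔰` is a realisation: morphisms of extensions are realised -/
  realizes_map : ∀ ⦃A B X A' B' X' : C⦄ (f : A ⟶ B) (g : B ⟶ X) (δ : S.Ext X A)
    (f' : A' ⟶ B') (g' : B' ⟶ X') (δ' : S.Ext X' A'),
    S.Realizes f g δ → S.Realizes f' g' δ' →
    ∀ (a : A ⟶ A') (c : X ⟶ X'), S.push a δ = S.pull c δ' →
      ∃ b : B ⟶ B', f ≫ b = a ≫ f' ∧ g ≫ c = b ≫ g'
  /-- (ET2) `𝔰` is additive: `𝔰(0)` is the class of the split sequence -/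
  realizes_split : ∀ ⦃A X : C⦄ (b : BinaryBicone A X), Nonempty b.IsBilimit →
    S.Realizes b.inl b.snd (0 : S.Ext X A)
  /-- (ET2) `𝔰` is additive: `𝔰(δ ⊕ δ') = 𝔰(δ) ⊕ 𝔰(δ')` -/
  realizes_sum : ∀ ⦃A B X A' B' X' : C⦄ (f : A ⟶ B) (g : B ⟶ X) (δ : S.Ext X A)
    (f' : A' ⟶ B') (g' : B' ⟶ X') (δ' : S.Ext X' A'),
    S.Realizes f g δ → S.Realizes f' g' δ' →
    ∀ (p : BinaryBicone A A') (q : BinaryBicone B B') (r : BinaryBicone X X'),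
      Nonempty p.IsBilimit → Nonempty q.IsBilimit → Nonempty r.IsBilimit →
      S.Realizes (p.fst ≫ f ≫ q.inl + p.snd ≫ f' ≫ q.inr)
        (q.fst ≫ g ≫ r.inl + q.snd ≫ g' ≫ r.inr)
        (S.push p.inl (S.pull r.fst δ) + S.push p.inr (S.pull r.snd δ'))
  /-- (ET3) -/
  et3 : ∀ ⦃A B X A' B' X' : C⦄ (f : A ⟶ B) (g : B ⟶ X) (δ : S.Ext X A)
    (f' : A' ⟶ B') (g' : B' ⟶ X') (δ' : S.Ext X' A'),
    S.Realizes f g δ → S.Realizes f' g' δ' →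
    ∀ (a : A ⟶ A') (b : B ⟶ B'), f ≫ b = a ≫ f' →
      ∃ c : X ⟶ X', g ≫ c = b ≫ g' ∧ S.push a δ = S.pull c δ'
  /-- (ET3)ᵒᵖ -/
  et3_op : ∀ ⦃A B X A' B' X' : C⦄ (f : A ⟶ B) (g : B ⟶ X) (δ : S.Ext X A)
    (f' : A' ⟶ B') (g' : B' ⟶ X') (δ' : S.Ext X' A'),
    S.Realizes f g δ → S.Realizes f' g' δ' →
    ∀ (b : B ⟶ B') (c : X ⟶ X'), g ≫ c = b ≫ g' →
      ∃ a : A ⟶ A', f ≫ b = a ≫ f' ∧ S.push a δ = S.pull c δ'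
  /-- (ET4) -/
  et4 : ∀ ⦃A B X D F : C⦄ (f : A ⟶ B) (f' : B ⟶ D) (δ : S.Ext D A)
    (g : B ⟶ X) (g' : X ⟶ F) (δ' : S.Ext F B),
    S.Realizes f f' δ → S.Realizes g g' δ' →
    ∃ (E : C) (h' : X ⟶ E) (d : D ⟶ E) (e : E ⟶ F) (δ'' : S.Ext E A),
      S.Realizes (f ≫ g) h' δ'' ∧ f' ≫ d = g ≫ h' ∧ h' ≫ e = g' ∧
      S.Realizes d e (S.push f' δ') ∧ S.pull d δ'' = δ ∧ S.push f δ'' = S.pull e δ'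
  /-- (ET4)ᵒᵖ -/
  et4_op : ∀ ⦃A B X D F : C⦄ (f' : D ⟶ A) (f : A ⟶ B) (δ : S.Ext B D)
    (g' : F ⟶ B) (g : B ⟶ X) (δ' : S.Ext X F),
    S.Realizes f' f δ → S.Realizes g' g δ' →
    ∃ (E : C) (d : D ⟶ E) (e : E ⟶ F) (h' : E ⟶ A) (δ'' : S.Ext X E),
      S.Realizes h' (f ≫ g) δ'' ∧ d ≫ h' = f' ∧ e ≫ g' = h' ≫ f ∧
      S.Realizes d e (S.pull g' δ) ∧ S.push e δ'' = δ' ∧ S.push d δ = S.pull g δ''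

/-- Frobenius extriangulated categories. -/
structure IsFrobenius : Prop extends S.IsExtriangulated where
  enough_proj : ∀ X : C, ∃ (P : C) (g : P ⟶ X), S.IsProj P ∧ S.Deflation g
  enough_inj : ∀ X : C, ∃ (I : C) (f : X ⟶ I), S.IsInj I ∧ S.Inflation f
  proj_iff_inj : ∀ P : C, S.IsProj P ↔ S.IsInj P

/-! ## The stable category and its suspension functor -/

/-- The stable category `C / (𝒫)`, with `𝒫` the projective-injective objects. -/
abbrev StableCat := IdealQuotient K S.IsProjInj

variable {S}

open scoped ZeroObject in
lemma IsExtriangulated.push_inflation_eq_zero (h : S.IsExtriangulated) {A B X : C} {f : A ⟶ B}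
    {g : B ⟶ X} {δ : S.Ext X A} (hδ : S.Realizes f g δ) : S.push f δ = 0 := by
  have := h.hasZeroObject
  have := h.hasBinaryBiproducts
  let b := BinaryBiproduct.bicone B (0 : C)
  have hb := h.realizes_split b ⟨BinaryBiproduct.isBilimit B 0⟩
  obtain ⟨c, -, hc⟩ := h.et3 f g δ b.inl b.snd 0 hδ hb f b.inl rfl
  rw [hc, map_zero]

lemma IsExtriangulated.factor_of_pull_eq_zero (h : S.IsExtriangulated) {A B X Z : C} {f : A ⟶ B}
    {g : B ⟶ X} {δ : S.Ext X A} (hδ : S.Realizes f g δ) (c : Z ⟶ X) (hc : S.pull c δ = 0) :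
    ∃ t : Z ⟶ B, t ≫ g = c := by
  have := h.hasBinaryBiproducts
  let b := BinaryBiproduct.bicone A Z
  have hb := h.realizes_split b ⟨BinaryBiproduct.isBilimit A Z⟩
  obtain ⟨t, -, ht⟩ := h.realizes_map b.inl b.snd 0 f g δ hb hδ (𝟙 A) c (by rw [hc, map_zero])
  refine ⟨b.inr ≫ t, ?_⟩
  rw [Category.assoc, ← ht, ← Category.assoc, b.inr_snd, Category.id_comp]

lemma IsExtriangulated.ext_injective_eq_zero (h : S.IsExtriangulated) {X I : C}
    (hI : S.IsInj I) (δ : S.Ext X I) : δ = 0 := by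
  obtain ⟨B, f, g, hδ⟩ := h.exists_realizes δ
  obtain ⟨r, hr⟩ := hI f ⟨X, g, δ, hδ⟩ (𝟙 I)
  rw [← push_id_apply δ, ← hr, push_comp_apply, h.push_inflation_eq_zero hδ, map_zero]

lemma IsExtriangulated.push_eq_zero_of_mem (h : S.IsExtriangulated) {X A A' : C} {a : A ⟶ A'}
    (ha : a ∈ objIdeal K S.IsProjInj A A') (δ : S.Ext X A) : S.push a δ = 0 := by
  refine Submodule.span_induction (p := fun a _ => S.push a δ = 0) ?_ ?_ ?_ ?_ ha
  · rintro _ ⟨Z, hZ, x, y, rfl⟩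
    rw [push_comp_apply, h.ext_injective_eq_zero hZ.2 (S.push x δ), map_zero]
  · have := h.push_smul (0 : K) (0 : A ⟶ A') δ
    simpa using this
  · intro x y _ _ hx hy
    rw [h.push_add, hx, hy, add_zero]
  · intro r x _ hx
    rw [h.push_smul, hx, smul_zero]

variable (S) in
/-- A conflation `X ⟶ I ⟶ S(X)` with `I` injective. -/
structure InjConflation (X : C) where
  hull : C
  susp : C
  infl : X ⟶ hull
  defl : hull ⟶ susp
  cls : S.Ext susp X
  realizes : S.Realizes infl defl cls
  injective : S.IsInj hull

lemma IsFrobenius.nonempty_injConflation (h : S.IsFrobenius) (X : C) :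
    Nonempty (S.InjConflation X) := by
  obtain ⟨I, f, hI, Y, g, δ, hδ⟩ := h.enough_inj X
  exact ⟨⟨I, Y, f, g, δ, hδ, hI⟩⟩

/-- The chosen conflation `X ⟶ I(X) ⟶ S(X)`. -/
noncomputable def IsFrobenius.injConflation (h : S.IsFrobenius) (X : C) : S.InjConflation X :=
  (h.nonempty_injConflation X).some

/-- `s` is the third component of a morphism of conflations from `E` to `E'` whose first component
is `f`. -/
def InjConflation.IsLift {X Y : C} (E : S.InjConflation X) (E' : S.InjConflation Y) (f : X ⟶ Y)
    (s : E.susp ⟶ E'.susp) : Prop :=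
  S.push f E.cls = S.pull s E'.cls ∧
    ∃ i : E.hull ⟶ E'.hull, E.infl ≫ i = f ≫ E'.infl ∧ E.defl ≫ s = i ≫ E'.defl

lemma IsFrobenius.exists_lift (h : S.IsFrobenius) {X Y : C} (E : S.InjConflation X)
    (E' : S.InjConflation Y) (f : X ⟶ Y) : ∃ s, E.IsLift E' f s := by
  obtain ⟨i, hi⟩ := E'.injective E.infl ⟨_, _, _, E.realizes⟩ (f ≫ E'.infl)
  obtain ⟨s, hs, hs'⟩ := h.et3 _ _ _ _ _ _ E.realizes E'.realizes f i hi
  exact ⟨s, hs', i, hi, hs⟩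

/-- Lifts of stably equal morphisms are stably equal. -/
lemma IsFrobenius.lift_unique (h : S.IsFrobenius) {X Y : C} {E : S.InjConflation X}
    {E' : S.InjConflation Y} {f f' : X ⟶ Y} (hf : idealRel K S.IsProjInj f f')
    {s s' : E.susp ⟶ E'.susp} (hs : S.push f E.cls = S.pull s E'.cls)
    (hs' : S.push f' E.cls = S.pull s' E'.cls) : idealRel K S.IsProjInj s s' := by
  have h0 : S.pull (s - s') E'.cls = 0 := by
    have h1 := h.pull_add (s - s') s' E'.cls
    have h2 := h.push_add (f - f') f' E.cls
    rw [sub_add_cancel] at h1 h2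
    rw [h.push_eq_zero_of_mem hf, zero_add, hs, hs', h1] at h2
    simpa using h2
  obtain ⟨t, ht⟩ := h.factor_of_pull_eq_zero E'.realizes _ h0
  exact Submodule.subset_span
    ⟨E'.hull, ⟨(h.proj_iff_inj _).2 E'.injective, E'.injective⟩, t, E'.defl, ht.symm⟩

/-- The chosen morphism `S(f) : S(X) ⟶ S(Y)`. -/
noncomputable def IsFrobenius.suspMap (h : S.IsFrobenius) {X Y : C} (f : X ⟶ Y) :
    (h.injConflation X).susp ⟶ (h.injConflation Y).susp :=
  (h.exists_lift (h.injConflation X) (h.injConflation Y) f).choose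

lemma IsFrobenius.suspMap_isLift (h : S.IsFrobenius) {X Y : C} (f : X ⟶ Y) :
    (h.injConflation X).IsLift (h.injConflation Y) f (h.suspMap f) :=
  (h.exists_lift (h.injConflation X) (h.injConflation Y) f).choose_spec

/-- The functor `C ⥤ C / (𝒫)`, `X ↦ S(X)`, `f ↦ S(f)`. -/
noncomputable def IsFrobenius.preSuspension (h : S.IsFrobenius) : C ⥤ S.StableCat where
  obj X := (Quotient.functor _).obj (h.injConflation X).susp
  map f := (Quotient.functor _).map (h.suspMap f)
  map_id X := by
    refine Eq.trans ?_ ((Quotient.functor (idealRel K S.IsProjInj)).map_id _)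
    refine (Quotient.functor_map_eq_iff _ _ _).2 ?_
    refine h.lift_unique (Congruence.equivalence.refl (𝟙 X)) (h.suspMap_isLift (𝟙 X)).1 ?_
    rw [push_id_apply, pull_id_apply]
  map_comp {X Y Z} f g := by
    rw [← Functor.map_comp]
    refine (Quotient.functor_map_eq_iff _ _ _).2 ?_
    refine h.lift_unique (Congruence.equivalence.refl (f ≫ g)) (h.suspMap_isLift (f ≫ g)).1 ?_
    rw [push_comp_apply, pull_comp_apply, (h.suspMap_isLift f).1, push_pull_apply,
      (h.suspMap_isLift g).1]

/-- The suspension functor `Σ` of the stable category. -/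
noncomputable def IsFrobenius.suspension (h : S.IsFrobenius) : S.StableCat ⥤ S.StableCat :=
  CategoryTheory.Quotient.lift _ h.preSuspension (fun _ _ _ _ hf =>
    (Quotient.functor_map_eq_iff _ _ _).2
      (h.lift_unique hf (h.suspMap_isLift _).1 (h.suspMap_isLift _).1))

variable (S) in
/-- Stably 2-Calabi–Yau Frobenius extriangulated categories: `C` is a `K`-linear Frobenius
extriangulated category and its stable category, with its suspension, is 2-Calabi–Yau. -/
def IsStablyTwoCYFrobenius : Prop :=
  ∃ h : S.IsFrobenius, IsTwoCalabiYau K S.StableCat h.suspension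

end ExtriData

end Extri

/-!
The argument is a reduction to vanishing statements about `𝔼`.

For a conflation `A ⟶ I ⟶ ΣA` with `I` injective, the connecting map `Hom(X, ΣA) → 𝔼(X, A)` is onto
and kills exactly the morphisms through projective-injectives, so `\underline{Hom}(X, ΣA) ≅ 𝔼(X, A)`.
As every object is stably a suspension, being stably 2-Calabi–Yau is therefore the same as a
natural duality `𝔼(X, A) ≅ D 𝔼(A, X)` between finite-dimensional spaces
(`isStablyTwoCYFrobenius_iff`). This formulation no longer mentions the stable category, and it
restricts to any full subcategory without further work. It also shows `𝒳^{⊥₁} = ^{⊥₁}𝒳`.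

The exact sequences of `𝔼` make `𝒳^{⊥₁}` closed under extensions, hence extriangulated
(`IsExtriangulated.restrict`). A right `𝒳`-approximation `X ⟶ Y` and a projective deflation
`P ⟶ Y` combine to a deflation `X ⊕ P ⟶ Y`, whose cocone is in `𝒳^{⊥₁}` because all morphisms from
`𝒳` to `Y` lift (`exists_deflation_rightPerp`). If `Y ∈ 𝒳^{⊥₁}`, this is a conflation in `𝒳^{⊥₁}`
whose middle term is projective there; dually for injectives, using `𝒳^{⊥₁} = ^{⊥₁}𝒳`. If `Y` is
itself projective in `𝒳^{⊥₁}` the conflation splits, so `Y ∈ add(𝒳, 𝒫)`.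

Approximations by `𝒳^{⊥₁}` come from universal extensions `A ⟶ D ⟶ X` and `X ⟶ D ⟶ A`. For
cluster-tilting subcategories, `𝒳 ⊆ 𝒯` forces the orthogonals of `𝒯` into `𝒳^{⊥₁}`, so that they are
the same computed in `𝒞` and in `𝒳^{⊥₁}`; functorial finiteness is transitive.
-/

namespace Extri

namespace ExtriData

/-! ### Vanishing of `𝔼`, orthogonal subcategories and duality -/

section Perp

variable {K : Type k} [Field K] {C : Type u} [Category.{v} C] {S : ExtriData.{w} K C}

lemma ext_retract_right_eq_zero {A B Z : C} (i : A ⟶ B) (r : B ⟶ A)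
    (hir : i ≫ r = 𝟙 A) (hB : ∀ ε : S.Ext Z B, ε = 0) (ε : S.Ext Z A) : ε = 0 := by
  rw [← push_id_apply ε, ← hir, push_comp_apply, hB (S.push i ε), map_zero]

lemma ext_retract_left_eq_zero {A B Z : C} (i : A ⟶ B) (r : B ⟶ A)
    (hir : i ≫ r = 𝟙 A) (hB : ∀ ε : S.Ext B Z, ε = 0) (ε : S.Ext A Z) : ε = 0 := by
  rw [← pull_id_apply ε, ← hir, pull_comp_apply, hB (S.pull r ε), map_zero]

/-- The bifunctor `𝔼` takes finite-dimensional values and satisfies `𝔼(X, A) ≅ D 𝔼(A, X)`,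
naturally in `X` and `A`. -/
def HasExtDuality (S : ExtriData.{w} K C) : Prop :=
  (∀ X A : C, FiniteDimensional K (S.Ext X A)) ∧
  ∃ φ : ∀ X A : C, S.Ext X A ≃ₗ[K] Module.Dual K (S.Ext A X),
    ∀ ⦃X X' A A' : C⦄ (f : X' ⟶ X) (g : A ⟶ A') (a : S.Ext X A) (b : S.Ext A' X'),
      φ X' A' (S.push g (S.pull f a)) b = φ X A a (S.push f (S.pull g b))

lemma HasExtDuality.ext_eq_zero_symm (hE : S.HasExtDuality) {X A : C}
    (h : ∀ ε : S.Ext X A, ε = 0) (ε : S.Ext A X) : ε = 0 := by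
  obtain ⟨-, φ, -⟩ := hE
  have : Subsingleton (S.Ext X A) := ⟨fun a b => (h a).trans (h b).symm⟩
  exact (φ A X).injective (LinearMap.ext fun b => by rw [Subsingleton.elim b 0]; simp)

lemma HasExtDuality.rightPerp_eq_leftPerp (hE : S.HasExtDuality) (𝒳 : ObjectProperty C) :
    S.rightPerp 𝒳 = S.leftPerp 𝒳 :=
  le_antisymm (fun _ hY _ hX => hE.ext_eq_zero_symm (hY hX))
    (fun _ hY _ hX => hE.ext_eq_zero_symm (hY hX))

lemma HasExtDuality.restrict (hE : S.HasExtDuality) (P : ObjectProperty C) :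
    (S.restrict P).HasExtDuality := by
  obtain ⟨hfd, φ, hφ⟩ := hE
  exact ⟨fun X A => hfd X.obj A.obj, fun X A => φ X.obj A.obj,
    fun _ _ _ _ f g a b => hφ f.hom g.hom a b⟩

lemma IsRigid.le_rightPerp {𝒳 : ObjectProperty C} (hrigid : S.IsRigid 𝒳) :
    𝒳 ≤ S.rightPerp 𝒳 := fun _ hX X' hX' => hrigid X' hX' hX

lemma leftPerp_restrict {P 𝒯 : ObjectProperty C} (h𝒯 : 𝒯 ≤ P) :
    (S.restrict P).leftPerp (𝒯.inverseImage P.ι) = (S.leftPerp 𝒯).inverseImage P.ι := by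
  ext Y
  exact ⟨fun H X hX => H (X := ⟨X, h𝒯 _ hX⟩) hX, fun H X hX => H (X := X.obj) hX⟩

lemma rightPerp_restrict {P 𝒯 : ObjectProperty C} (h𝒯 : 𝒯 ≤ P) :
    (S.restrict P).rightPerp (𝒯.inverseImage P.ι) = (S.rightPerp 𝒯).inverseImage P.ι := by
  ext Y
  exact ⟨fun H X hX => H (X := ⟨X, h𝒯 _ hX⟩) hX, fun H X hX => H (X := X.obj) hX⟩

lemma rightPerp_anti {𝒳 𝒯 : ObjectProperty C} (h : 𝒳 ≤ 𝒯) : S.rightPerp 𝒯 ≤ S.rightPerp 𝒳 :=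
  fun _ hY _ hX => hY (h _ hX)

end Perp

variable {K : Type k} [Field K] {C : Type u} [Category.{v} C] [Preadditive C] [Linear K C]
  {S : ExtriData.{w} K C}

/-! ### Exact sequences attached to a conflation -/

namespace IsExtriangulated

lemma pull_zero_map (h : S.IsExtriangulated) {X X' A : C} (δ : S.Ext X A) :
    S.pull (0 : X' ⟶ X) δ = 0 := by
  simpa using h.pull_smul (0 : K) (0 : X' ⟶ X) δ

lemma push_zero_map (h : S.IsExtriangulated) {X A A' : C} (δ : S.Ext X A) :
    S.push (0 : A ⟶ A') δ = 0 := by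
  simpa using h.push_smul (0 : K) (0 : A ⟶ A') δ

lemma ext_eq_zero_of_isZero_left (h : S.IsExtriangulated) {X A : C} (hX : IsZero X)
    (δ : S.Ext X A) : δ = 0 := by
  rw [← pull_id_apply δ, hX.eq_of_src (𝟙 X) 0, h.pull_zero_map]

lemma ext_eq_zero_of_isZero_right (h : S.IsExtriangulated) {X A : C} (hA : IsZero A)
    (δ : S.Ext X A) : δ = 0 := by
  rw [← push_id_apply δ, hA.eq_of_src (𝟙 A) 0, h.push_zero_map]

/-- Exactness of `Hom(B, Z) → Hom(A, Z) → 𝔼(X, Z)`. -/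
lemma factor_of_push_eq_zero (h : S.IsExtriangulated) {A B X Z : C} {f : A ⟶ B}
    {g : B ⟶ X} {δ : S.Ext X A} (hδ : S.Realizes f g δ) (a : A ⟶ Z) (ha : S.push a δ = 0) :
    ∃ t : B ⟶ Z, f ≫ t = a := by
  have := h.hasBinaryBiproducts
  let b := BinaryBiproduct.bicone Z X
  have hb := h.realizes_split b ⟨BinaryBiproduct.isBilimit Z X⟩
  obtain ⟨t, ht, -⟩ := h.realizes_map f g δ b.inl b.snd 0 hδ hb a (𝟙 X) (by rw [ha, map_zero])
  refine ⟨t ≫ b.fst, ?_⟩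
  rw [← Category.assoc, ht, Category.assoc, b.inl_fst, Category.comp_id]

open scoped ZeroObject in
lemma pull_deflation_eq_zero (h : S.IsExtriangulated) {A B X : C} {f : A ⟶ B}
    {g : B ⟶ X} {δ : S.Ext X A} (hδ : S.Realizes f g δ) : S.pull g δ = 0 := by
  have := h.hasZeroObject
  have := h.hasBinaryBiproducts
  let b := BinaryBiproduct.bicone (0 : C) B
  have hb := h.realizes_split b ⟨BinaryBiproduct.isBilimit 0 B⟩
  obtain ⟨c, -, hc⟩ := h.et3_op b.inl b.snd 0 f g δ hb hδ b.snd g rfl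
  rw [← hc, map_zero]

/-- Exactness of `Hom(Z, X) → 𝔼(Z, A) → 𝔼(Z, B)`. -/
lemma exists_pull_eq (h : S.IsExtriangulated) {A B X Z : C} {f : A ⟶ B}
    {g : B ⟶ X} {δ : S.Ext X A} (hδ : S.Realizes f g δ) (ε : S.Ext Z A)
    (hε : S.push f ε = 0) : ∃ c : Z ⟶ X, S.pull c δ = ε := by
  obtain ⟨M, m, n, hM⟩ := h.exists_realizes ε
  obtain ⟨t, ht⟩ := h.factor_of_push_eq_zero hM f hε
  obtain ⟨c, -, hc⟩ := h.et3 m n ε f g δ hM hδ (𝟙 A) t (by rw [ht, Category.id_comp])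
  exact ⟨c, by rw [← hc, push_id_apply]⟩

/-- Exactness of `Hom(A, Z) → 𝔼(X, Z) → 𝔼(B, Z)`. -/
lemma exists_push_eq (h : S.IsExtriangulated) {A B X Z : C} {f : A ⟶ B}
    {g : B ⟶ X} {δ : S.Ext X A} (hδ : S.Realizes f g δ) (ε : S.Ext X Z)
    (hε : S.pull g ε = 0) : ∃ a : A ⟶ Z, S.push a δ = ε := by
  obtain ⟨M, m, n, hM⟩ := h.exists_realizes ε
  obtain ⟨t, ht⟩ := h.factor_of_pull_eq_zero hM g hε
  obtain ⟨a, -, ha⟩ := h.et3_op f g δ m n ε hδ hM t (𝟙 X) (by rw [ht, Category.comp_id])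
  exact ⟨a, by rw [ha, pull_id_apply]⟩

/-- Exactness of `𝔼(Z, A) → 𝔼(Z, B) → 𝔼(Z, X)`. -/
lemma exists_push_infl_eq (h : S.IsExtriangulated) {A B X Z : C} {f : A ⟶ B}
    {g : B ⟶ X} {δ : S.Ext X A} (hδ : S.Realizes f g δ) (ε : S.Ext Z B)
    (hε : S.push g ε = 0) : ∃ ε' : S.Ext Z A, S.push f ε' = ε := by
  obtain ⟨M, m, n, hM⟩ := h.exists_realizes ε
  -- In the octahedron over `A ⟶ B ⟶ M`, the conflation `X ⟶ E ⟶ Z` has class `g_* ε = 0`.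
  obtain ⟨E, -, d, e, δ'', -, -, -, hde, -, hfe⟩ := h.et4 f g δ m n ε hδ hM
  obtain ⟨s, hs⟩ := h.factor_of_pull_eq_zero hde (𝟙 Z) (by rw [hε, map_zero])
  refine ⟨S.pull s δ'', ?_⟩
  rw [push_pull_apply, hfe, ← pull_comp_apply, hs, pull_id_apply]

/-- Exactness of `𝔼(X, Z) → 𝔼(B, Z) → 𝔼(A, Z)`. -/
lemma exists_pull_defl_eq (h : S.IsExtriangulated) {A B X Z : C} {f : A ⟶ B}
    {g : B ⟶ X} {δ : S.Ext X A} (hδ : S.Realizes f g δ) (ε : S.Ext B Z)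
    (hε : S.pull f ε = 0) : ∃ ε' : S.Ext X Z, S.pull g ε' = ε := by
  obtain ⟨M, m, n, hM⟩ := h.exists_realizes ε
  -- In the octahedron over `M ⟶ B ⟶ X`, the conflation `Z ⟶ E ⟶ A` has class `f^* ε = 0`.
  obtain ⟨E, d, e, -, δ'', -, -, -, hde, -, hde'⟩ := h.et4_op m n ε f g δ hM hδ
  obtain ⟨s, hs⟩ := h.factor_of_push_eq_zero hde (𝟙 Z) (by rw [hε, map_zero])
  refine ⟨S.push s δ'', ?_⟩
  rw [← push_pull_apply, ← hde', ← push_comp_apply, hs, push_id_apply]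

lemma ext_middle_right_eq_zero (h : S.IsExtriangulated) {A B X Z : C} {f : A ⟶ B}
    {g : B ⟶ X} {δ : S.Ext X A} (hδ : S.Realizes f g δ) (hA : ∀ ε : S.Ext Z A, ε = 0)
    (hX : ∀ ε : S.Ext Z X, ε = 0) (ε : S.Ext Z B) : ε = 0 := by
  obtain ⟨ε', rfl⟩ := h.exists_push_infl_eq hδ ε (hX _)
  rw [hA ε', map_zero]

lemma ext_middle_left_eq_zero (h : S.IsExtriangulated) {A B X Z : C} {f : A ⟶ B}
    {g : B ⟶ X} {δ : S.Ext X A} (hδ : S.Realizes f g δ) (hA : ∀ ε : S.Ext A Z, ε = 0)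
    (hX : ∀ ε : S.Ext X Z, ε = 0) (ε : S.Ext B Z) : ε = 0 := by
  obtain ⟨ε', rfl⟩ := h.exists_pull_defl_eq hδ ε (hA _)
  rw [hX ε', map_zero]

/-! ### Projective and injective objects, sums and deflations -/

lemma ext_proj_eq_zero (h : S.IsExtriangulated) {P A : C} (hP : S.IsProj P) (δ : S.Ext P A) :
    δ = 0 := by
  obtain ⟨B, f, g, hδ⟩ := h.exists_realizes δ
  obtain ⟨s, hs⟩ := hP g ⟨A, f, δ, hδ⟩ (𝟙 P)
  rw [← pull_id_apply δ, ← hs, pull_comp_apply, h.pull_deflation_eq_zero hδ, map_zero]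

lemma isProj_iff (h : S.IsExtriangulated) (P : C) :
    S.IsProj P ↔ ∀ (A : C) (δ : S.Ext P A), δ = 0 :=
  ⟨fun hP _ δ => h.ext_proj_eq_zero hP δ, fun hP _ _ _ ⟨_, _, _, hδ⟩ c =>
    h.factor_of_pull_eq_zero hδ c (hP _ _)⟩

lemma isInj_iff (h : S.IsExtriangulated) (I : C) :
    S.IsInj I ↔ ∀ (X : C) (δ : S.Ext X I), δ = 0 :=
  ⟨fun hI _ δ => h.ext_injective_eq_zero hI δ, fun hI _ _ _ ⟨_, _, _, hδ⟩ a =>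
    h.factor_of_push_eq_zero hδ a (hI _ _)⟩

lemma ext_biprod_right_eq_zero (h : S.IsExtriangulated) {A B Z : C} (b : BinaryBicone A B)
    (hb : Nonempty b.IsBilimit) (hA : ∀ ε : S.Ext Z A, ε = 0) (hB : ∀ ε : S.Ext Z B, ε = 0)
    (ε : S.Ext Z b.pt) : ε = 0 :=
  h.ext_middle_right_eq_zero (h.realizes_split b hb) hA hB ε

lemma ext_biprod_left_eq_zero (h : S.IsExtriangulated) {A B Z : C} (b : BinaryBicone A B)
    (hb : Nonempty b.IsBilimit) (hA : ∀ ε : S.Ext A Z, ε = 0) (hB : ∀ ε : S.Ext B Z, ε = 0)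
    (ε : S.Ext b.pt Z) : ε = 0 :=
  h.ext_middle_left_eq_zero (h.realizes_split b hb) hA hB ε

open scoped ZeroObject in
lemma realizes_id_zero (h : S.IsExtriangulated) (X : C) :
    haveI := h.hasZeroObject
    S.Realizes (0 : (0 : C) ⟶ X) (𝟙 X) 0 := by
  have := h.hasZeroObject
  exact h.realizes_split
    { pt := X, fst := 0, snd := 𝟙 X, inl := 0, inr := 𝟙 X
      inl_fst := (isZero_zero C).eq_of_src _ _ } ⟨isBinaryBilimitOfTotal _ (by simp)⟩

open scoped ZeroObject in
lemma realizes_zero_id (h : S.IsExtriangulated) (X : C) :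
    haveI := h.hasZeroObject
    S.Realizes (𝟙 X) (0 : X ⟶ (0 : C)) 0 := by
  have := h.hasZeroObject
  exact h.realizes_split
    { pt := X, fst := 𝟙 X, snd := 0, inl := 𝟙 X, inr := 0
      inr_snd := (isZero_zero C).eq_of_src _ _ } ⟨isBinaryBilimitOfTotal _ (by simp)⟩

/-- If `p : P ⟶ Y` is a deflation, so is `(x, p) : X ⊕ P ⟶ Y` for every `x : X ⟶ Y`. -/
lemma deflation_desc (h : S.IsExtriangulated) {X P Y : C} (x : X ⟶ Y) {p : P ⟶ Y}
    (hp : S.Deflation p) :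
    haveI := h.hasBinaryBiproducts
    S.Deflation (biprod.desc x p) := by
  have := h.hasZeroObject
  have := h.hasBinaryBiproducts
  obtain ⟨A, f, δ, hδ⟩ := hp
  -- `(x, p)` is the deflation `𝟙 ⊕ p` followed by a sheared projection `X ⊕ Y ⟶ Y`.
  have h1 := h.realizes_sum _ _ _ _ _ _ (h.realizes_id_zero X) hδ _ _ _
    ⟨BinaryBiproduct.isBilimit _ _⟩ ⟨BinaryBiproduct.isBilimit _ _⟩
    ⟨BinaryBiproduct.isBilimit _ _⟩
  have h2 := h.realizes_split (A := X) (X := Y)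
    { pt := X ⊞ Y
      fst := biprod.fst
      snd := biprod.desc x (𝟙 Y)
      inl := biprod.lift (𝟙 X) (-x)
      inr := biprod.inr } ⟨isBinaryBilimitOfTotal _ (by ext <;> simp)⟩
  obtain ⟨E, -, -, k, ε, hε, -⟩ := h.et4_op _ _ _ _ _ _ h1 h2
  refine ⟨E, k, ε, ?_⟩
  convert hε using 1
  ext <;> simp

/-- If `i : Y ⟶ I` is an inflation, so is `(x, i) : Y ⟶ X ⊕ I` for every `x : Y ⟶ X`. -/
lemma inflation_lift (h : S.IsExtriangulated) {X I Y : C} (x : Y ⟶ X) {i : Y ⟶ I}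
    (hi : S.Inflation i) :
    haveI := h.hasBinaryBiproducts
    S.Inflation (biprod.lift x i) := by
  have := h.hasZeroObject
  have := h.hasBinaryBiproducts
  obtain ⟨A, g, δ, hδ⟩ := hi
  -- `(x, i)` is the sheared inclusion `Y ⟶ X ⊕ Y` followed by the inflation `𝟙 ⊕ i`.
  have h1 := h.realizes_sum _ _ _ _ _ _ (h.realizes_zero_id X) hδ _ _ _
    ⟨BinaryBiproduct.isBilimit _ _⟩ ⟨BinaryBiproduct.isBilimit _ _⟩
    ⟨BinaryBiproduct.isBilimit _ _⟩
  have h2 := h.realizes_split (A := Y) (X := X)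
    { pt := X ⊞ Y
      fst := biprod.snd
      snd := biprod.desc (𝟙 X) (-x)
      inl := biprod.lift x (𝟙 Y)
      inr := biprod.inl } ⟨isBinaryBilimitOfTotal _ (by ext <;> simp)⟩
  obtain ⟨E, k, -, -, ε, hε, -⟩ := h.et4 _ _ _ _ _ _ h2 h1
  refine ⟨E, k, ε, ?_⟩
  convert hε using 1
  ext <;> simp

end IsExtriangulated

/-! ### The 2-Calabi–Yau property in terms of `𝔼` -/

/-- The connecting map `Hom(X, ΣA) → 𝔼(X, A)` of a conflation `A ⟶ I ⟶ ΣA`. -/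
def IsExtriangulated.connecting (h : S.IsExtriangulated) {A : C} (E : S.InjConflation A) (X : C) :
    (X ⟶ E.susp) →ₗ[K] S.Ext X A where
  toFun c := S.pull c E.cls
  map_add' c c' := h.pull_add c c' E.cls
  map_smul' r c := h.pull_smul r c E.cls

lemma IsExtriangulated.connecting_surjective (h : S.IsExtriangulated) {A : C}
    (E : S.InjConflation A) (X : C) : Function.Surjective (h.connecting E X) := fun ε =>
  h.exists_pull_eq E.realizes ε (h.ext_injective_eq_zero E.injective _)

lemma IsFrobenius.ker_connecting (h : S.IsFrobenius) {A : C} (E : S.InjConflation A) (X : C) :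
    LinearMap.ker (h.connecting E X) = objIdeal K S.IsProjInj X E.susp := by
  apply le_antisymm
  · intro c hc
    obtain ⟨t, ht⟩ := h.factor_of_pull_eq_zero E.realizes c hc
    exact Submodule.subset_span
      ⟨E.hull, ⟨(h.proj_iff_inj _).2 E.injective, E.injective⟩, t, E.defl, ht.symm⟩
  · refine Submodule.span_le.2 ?_
    rintro _ ⟨Z, hZ, a, b, rfl⟩
    change S.pull (a ≫ b) E.cls = 0
    rw [pull_comp_apply, h.ext_proj_eq_zero hZ.1 (S.pull b E.cls), map_zero]

/-- The projection `Hom(X, Y) → \underline{Hom}(X, Y)` as a linear map. -/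
def stableMap (S : ExtriData.{w} K C) (X Y : C) :
    (X ⟶ Y) →ₗ[K] ((⟨X⟩ : S.StableCat) ⟶ ⟨Y⟩) where
  toFun c := (Quotient.functor (idealRel K S.IsProjInj)).map c
  map_add' _ _ := Functor.map_add _
  map_smul' _ _ := rfl

lemma stableMap_surjective (X Y : C) : Function.Surjective (S.stableMap X Y) :=
  (Quotient.functor (idealRel K S.IsProjInj)).map_surjective

lemma ker_stableMap (X Y : C) :
    LinearMap.ker (S.stableMap X Y) = objIdeal K S.IsProjInj X Y := by
  ext c
  rw [LinearMap.mem_ker, ← map_zero (S.stableMap X Y)]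
  refine (Quotient.functor_map_eq_iff (idealRel K S.IsProjInj) c 0).trans ?_
  simp [idealRel]

/-- The isomorphism between stable morphisms `X ⟶ ΣA` and `𝔼(X, A)`. -/
noncomputable def IsFrobenius.stableHomEquiv (h : S.IsFrobenius) {A : C} (E : S.InjConflation A)
    (X : C) : ((⟨X⟩ : S.StableCat) ⟶ ⟨E.susp⟩) ≃ₗ[K] S.Ext X A :=
  ((S.stableMap X E.susp).quotKerEquivOfSurjective (stableMap_surjective _ _)).symm ≪≫ₗ
    Submodule.quotEquivOfEq _ _ ((ker_stableMap X E.susp).trans (h.ker_connecting E X).symm) ≪≫ₗ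
    (h.connecting E X).quotKerEquivOfSurjective (h.connecting_surjective E X)

lemma IsFrobenius.stableHomEquiv_stableMap (h : S.IsFrobenius) {A : C} (E : S.InjConflation A)
    {X : C} (c : X ⟶ E.susp) :
    h.stableHomEquiv E X (S.stableMap X E.susp c) = S.pull c E.cls := by
  have : ((S.stableMap X E.susp).quotKerEquivOfSurjective (stableMap_surjective _ _)).symm
      (S.stableMap X E.susp c) = Submodule.Quotient.mk c := by
    rw [LinearEquiv.symm_apply_eq]
    rfl
  simp only [stableHomEquiv, LinearEquiv.trans_apply, this]
  rfl

/-- The isomorphism `Ext¹(X, Y) ≅ 𝔼(X, Y)`, the left-hand side taken in the stable category. -/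
noncomputable def IsFrobenius.stableExtEquiv (h : S.IsFrobenius) (X Y : S.StableCat) :
    (X ⟶ h.suspension.obj Y) ≃ₗ[K] S.Ext X.as Y.as :=
  h.stableHomEquiv (h.injConflation Y.as) X.as

lemma IsFrobenius.stableExtEquiv_naturality (h : S.IsFrobenius) {X X' Y Y' : C} (f : X' ⟶ X)
    (g : Y ⟶ Y') (a : (⟨X⟩ : S.StableCat) ⟶ h.suspension.obj ⟨Y⟩) :
    h.stableExtEquiv ⟨X'⟩ ⟨Y'⟩ (S.stableMap X' X f ≫ a ≫ h.suspension.map (S.stableMap Y Y' g)) =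
      S.push g (S.pull f (h.stableExtEquiv ⟨X⟩ ⟨Y⟩ a)) := by
  obtain ⟨a, rfl⟩ := stableMap_surjective _ _ a
  have : S.stableMap X' X f ≫ S.stableMap X _ a ≫ h.suspension.map (S.stableMap Y Y' g) =
      S.stableMap X' _ (f ≫ a ≫ h.suspMap g) := rfl
  refine (congrArg _ this).trans ((h.stableHomEquiv_stableMap _ _).trans ?_)
  refine Eq.trans ?_ (congrArg (fun t => S.push g (S.pull f t))
    (h.stableHomEquiv_stableMap (h.injConflation Y) a).symm)
  rw [pull_comp_apply, pull_comp_apply, ← (h.suspMap_isLift g).1, push_pull_apply,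
    push_pull_apply]

/-- Every object `Z` is stably a suspension: a projective deflation onto `Z` has an injective
source. -/
lemma IsFrobenius.exists_injConflation_susp_eq (h : S.IsFrobenius) (Z : C) :
    ∃ (A : C) (E : S.InjConflation A), E.susp = Z := by
  obtain ⟨P, g, hP, A, f, δ, hδ⟩ := h.enough_proj Z
  exact ⟨A, ⟨P, Z, f, g, δ, hδ, (h.proj_iff_inj P).1 hP⟩, rfl⟩

lemma IsFrobenius.isTwoCalabiYau_iff (h : S.IsFrobenius) :
    IsTwoCalabiYau K S.StableCat h.suspension ↔ S.HasExtDuality := by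
  constructor
  · rintro ⟨hfd, φ, hφ⟩
    refine ⟨fun X A => Module.Finite.equiv (h.stableExtEquiv ⟨X⟩ ⟨A⟩), fun X A =>
      (h.stableExtEquiv ⟨X⟩ ⟨A⟩).symm ≪≫ₗ φ ⟨X⟩ ⟨A⟩ ≪≫ₗ
        (h.stableExtEquiv ⟨A⟩ ⟨X⟩).symm.dualMap, ?_⟩
    intro X X' A A' f g a b
    obtain ⟨a, rfl⟩ := (h.stableExtEquiv ⟨X⟩ ⟨A⟩).surjective a
    obtain ⟨b, rfl⟩ := (h.stableExtEquiv ⟨A'⟩ ⟨X'⟩).surjective b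
    rw [← h.stableExtEquiv_naturality, ← h.stableExtEquiv_naturality]
    simpa using hφ (S.stableMap _ _ f) (S.stableMap _ _ g) a b
  · rintro ⟨hfd, φ, hφ⟩
    refine ⟨?_, fun X Y => h.stableExtEquiv X Y ≪≫ₗ φ X.as Y.as ≪≫ₗ
      (h.stableExtEquiv Y X).dualMap, ?_⟩
    · rintro ⟨X⟩ ⟨Z⟩
      obtain ⟨A, E, rfl⟩ := h.exists_injConflation_susp_eq Z
      exact Module.Finite.equiv (h.stableHomEquiv E X).symm
    · rintro ⟨X⟩ ⟨X'⟩ ⟨Y⟩ ⟨Y'⟩ f g a b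
      obtain ⟨f, rfl⟩ := stableMap_surjective _ _ f
      obtain ⟨g, rfl⟩ := stableMap_surjective _ _ g
      simp only [LinearEquiv.trans_apply, LinearEquiv.dualMap_apply]
      rw [h.stableExtEquiv_naturality, h.stableExtEquiv_naturality]
      exact hφ f g _ _

lemma isStablyTwoCYFrobenius_iff :
    S.IsStablyTwoCYFrobenius ↔ S.IsFrobenius ∧ S.HasExtDuality :=
  ⟨fun ⟨h, hCY⟩ => ⟨h, h.isTwoCalabiYau_iff.1 hCY⟩,
    fun ⟨h, hE⟩ => ⟨h, h.isTwoCalabiYau_iff.2 hE⟩⟩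

end ExtriData

/-! ### Functorial finiteness and weak idempotent completeness of full subcategories -/

section Subcategories

variable {C : Type u} [Category.{v} C]

/-- Functorial finiteness is transitive. -/
lemma FunctoriallyFinite.of_inverseImage_ι {P Q : ObjectProperty C} (hPQ : P ≤ Q)
    (hQ : FunctoriallyFinite Q) (hP : FunctoriallyFinite (P.inverseImage Q.ι)) :
    FunctoriallyFinite P := by
  refine ⟨fun A => ?_, fun A => ?_⟩
  · obtain ⟨Y, f, hY, hf⟩ := hQ.1 A
    obtain ⟨X, g, hX, hg⟩ := hP.1 ⟨Y, hY⟩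
    refine ⟨X.obj, g.hom ≫ f, hX, fun X' hX' a => ?_⟩
    obtain ⟨b, rfl⟩ := hf (hPQ _ hX') a
    obtain ⟨c, hc⟩ := hg (X' := ⟨X', hPQ _ hX'⟩) hX' (ObjectProperty.homMk b)
    exact ⟨c.hom, by rw [← Category.assoc]; exact congrArg (fun t => t.hom ≫ f) hc⟩
  · obtain ⟨Y, f, hY, hf⟩ := hQ.2 A
    obtain ⟨X, g, hX, hg⟩ := hP.2 ⟨Y, hY⟩
    refine ⟨X.obj, f ≫ g.hom, hX, fun X' hX' a => ?_⟩
    obtain ⟨b, rfl⟩ := hf (hPQ _ hX') a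
    obtain ⟨c, hc⟩ := hg (X' := ⟨X', hPQ _ hX'⟩) hX' (ObjectProperty.homMk b)
    exact ⟨c.hom, by rw [Category.assoc]; exact congrArg (fun t => f ≫ t.hom) hc⟩

lemma FunctoriallyFinite.inverseImage_ι {P Q : ObjectProperty C} (hPQ : P ≤ Q)
    (hP : FunctoriallyFinite P) : FunctoriallyFinite (P.inverseImage Q.ι) := by
  refine ⟨fun A => ?_, fun A => ?_⟩
  · obtain ⟨X, f, hX, hf⟩ := hP.1 A.obj
    refine ⟨⟨X, hPQ _ hX⟩, ObjectProperty.homMk f, hX, fun X' hX' a => ?_⟩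
    obtain ⟨b, hb⟩ := hf hX' a.hom
    exact ⟨ObjectProperty.homMk b, ObjectProperty.hom_ext _ hb⟩
  · obtain ⟨X, f, hX, hf⟩ := hP.2 A.obj
    refine ⟨⟨X, hPQ _ hX⟩, ObjectProperty.homMk f, hX, fun X' hX' a => ?_⟩
    obtain ⟨b, hb⟩ := hf hX' a.hom
    exact ⟨ObjectProperty.homMk b, ObjectProperty.hom_ext _ hb⟩

lemma inverseImage_ι_inj {P Q R : ObjectProperty C} (hQ : Q ≤ P) (hR : R ≤ P)
    (hQR : Q.inverseImage P.ι = R.inverseImage P.ι) : Q = R := by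
  ext Y
  exact ⟨fun hY => (congrFun hQR ⟨Y, hQ _ hY⟩).mp hY, fun hY => (congrFun hQR ⟨Y, hR _ hY⟩).mpr hY⟩

variable [Preadditive C]

/-- Weak idempotent completeness passes to full subcategories closed under retracts: the kernel of
a retraction is a retract of its source. -/
lemma WeaklyIdempotentComplete.fullSubcategory (hC : WeaklyIdempotentComplete C)
    (P : ObjectProperty C) (hP : ∀ ⦃X Y : C⦄ (i : X ⟶ Y) (r : Y ⟶ X), i ≫ r = 𝟙 X → P Y → P X) :
    WeaklyIdempotentComplete P.FullSubcategory := by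
  intro X Y f hf
  obtain ⟨⟨s, hs⟩⟩ := hf
  have hs : s.hom ≫ f.hom = 𝟙 Y.obj := congrArg (fun t => t.hom) hs
  have := hC f.hom ⟨⟨s.hom, hs⟩⟩
  -- `𝟙 - f ≫ s` factors through the kernel and splits its inclusion.
  let r : X.obj ⟶ kernel f.hom := kernel.lift f.hom (𝟙 _ - f.hom ≫ s.hom) (by simp [hs])
  have hr : kernel.ι f.hom ≫ r = 𝟙 _ := by
    rw [← cancel_mono (kernel.ι f.hom), Category.assoc, kernel.lift_ι]
    simp
  let N : P.FullSubcategory := ⟨kernel f.hom, hP _ r hr X.property⟩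
  let i : N ⟶ X := ObjectProperty.homMk (kernel.ι f.hom)
  have : Mono i := ⟨fun a b hab => ObjectProperty.hom_ext _
    ((cancel_mono (kernel.ι f.hom)).1 (congrArg (fun t => t.hom) hab))⟩
  exact ⟨⟨⟨KernelFork.ofι i (ObjectProperty.hom_ext _ (kernel.condition f.hom)),
    KernelFork.IsLimit.ofι' i _ fun {A} k hk => ⟨ObjectProperty.homMk
      (kernel.lift f.hom k.hom (congrArg (fun t => t.hom) hk)),
      ObjectProperty.hom_ext _ (kernel.lift_ι _ _ _)⟩⟩⟩⟩

end Subcategories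

namespace ExtriData

variable {K : Type k} [Field K] {C : Type u} [Category.{v} C] [Preadditive C] [Linear K C]
  {S : ExtriData.{w} K C}

/-! ### Extension-closed subcategories are extriangulated -/

lemma nonempty_isBilimit_mapBinaryBicone_ι (P : ObjectProperty C) {X Y : P.FullSubcategory}
    (b : BinaryBicone X Y) (hb : Nonempty b.IsBilimit) :
    Nonempty (P.ι.mapBinaryBicone b).IsBilimit :=
  ⟨isBinaryBilimitOfTotal _ (congrArg (fun t => t.hom) (IsBilimit.binary_total hb.some))⟩

/-- A full subcategory which contains a zero object and is closed under extensions is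
extriangulated. -/
lemma IsExtriangulated.restrict (h : S.IsExtriangulated) (P : ObjectProperty C)
    (h0 : ∃ Z, P Z ∧ IsZero Z)
    (hP : ∀ ⦃A B X : C⦄ (f : A ⟶ B) (g : B ⟶ X) (δ : S.Ext X A),
      S.Realizes f g δ → P A → P X → P B) :
    (S.restrict P).IsExtriangulated where
  hasZeroObject := by
    obtain ⟨Z, hZ, hZ0⟩ := h0
    refine ⟨⟨Z, hZ⟩, (IsZero.iff_id_eq_zero _).2 (ObjectProperty.hom_ext _ (hZ0.eq_of_src _ _))⟩
  hasBinaryBiproducts := by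
    have := h.hasBinaryBiproducts
    refine ⟨fun X Y => ?_⟩
    have hXY : P (X.obj ⊞ Y.obj) := hP _ _ _
      (h.realizes_split _ ⟨BinaryBiproduct.isBilimit X.obj Y.obj⟩) X.property Y.property
    exact hasBinaryBiproduct_of_total
      { pt := ⟨X.obj ⊞ Y.obj, hXY⟩
        fst := ObjectProperty.homMk biprod.fst
        snd := ObjectProperty.homMk biprod.snd
        inl := ObjectProperty.homMk biprod.inl
        inr := ObjectProperty.homMk biprod.inr
        inl_fst := ObjectProperty.hom_ext _ biprod.inl_fst
        inl_snd := ObjectProperty.hom_ext _ biprod.inl_snd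
        inr_fst := ObjectProperty.hom_ext _ biprod.inr_fst
        inr_snd := ObjectProperty.hom_ext _ biprod.inr_snd }
      (ObjectProperty.hom_ext _ biprod.total)
  push_add _ _ _ a a' δ := h.push_add a.hom a'.hom δ
  push_smul _ _ _ r a δ := h.push_smul r a.hom δ
  pull_add _ _ _ c c' δ := h.pull_add c.hom c'.hom δ
  pull_smul _ _ _ r c δ := h.pull_smul r c.hom δ
  exists_realizes X A δ := by
    obtain ⟨B, f, g, hδ⟩ := h.exists_realizes (X := X.obj) (A := A.obj) δ
    exact ⟨⟨B, hP _ _ _ hδ A.property X.property⟩, ObjectProperty.homMk f,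
      ObjectProperty.homMk g, hδ⟩
  comp_zero _ _ _ f g δ hδ := ObjectProperty.hom_ext _ (h.comp_zero f.hom g.hom δ hδ)
  realizes_unique _ _ _ _ f g f' g' δ hδ hδ' := by
    obtain ⟨e, he, he'⟩ := h.realizes_unique f.hom g.hom f'.hom g'.hom δ hδ hδ'
    exact ⟨P.isoMk e, ObjectProperty.hom_ext _ he, ObjectProperty.hom_ext _ he'⟩
  realizes_iso _ _ _ _ f g f' g' δ e he he' hδ :=
    h.realizes_iso f.hom g.hom f'.hom g'.hom δ (P.ι.mapIso e) (congrArg (fun t => t.hom) he)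
      (congrArg (fun t => t.hom) he') hδ
  realizes_map _ _ _ _ _ _ f g δ f' g' δ' hδ hδ' a c hac := by
    obtain ⟨b, hb, hb'⟩ := h.realizes_map f.hom g.hom δ f'.hom g'.hom δ' hδ hδ' a.hom c.hom hac
    exact ⟨ObjectProperty.homMk b, ObjectProperty.hom_ext _ hb, ObjectProperty.hom_ext _ hb'⟩
  realizes_split _ _ b hb := h.realizes_split (P.ι.mapBinaryBicone b)
    (nonempty_isBilimit_mapBinaryBicone_ι P b hb)
  realizes_sum _ _ _ _ _ _ f g δ f' g' δ' hδ hδ' p q r hp hq hr :=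
    h.realizes_sum f.hom g.hom δ f'.hom g'.hom δ' hδ hδ' (P.ι.mapBinaryBicone p)
      (P.ι.mapBinaryBicone q) (P.ι.mapBinaryBicone r) (nonempty_isBilimit_mapBinaryBicone_ι P p hp)
      (nonempty_isBilimit_mapBinaryBicone_ι P q hq) (nonempty_isBilimit_mapBinaryBicone_ι P r hr)
  et3 _ _ _ _ _ _ f g δ f' g' δ' hδ hδ' a b hab := by
    obtain ⟨c, hc, hc'⟩ := h.et3 f.hom g.hom δ f'.hom g'.hom δ' hδ hδ' a.hom b.hom
      (congrArg (fun t => t.hom) hab)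
    exact ⟨ObjectProperty.homMk c, ObjectProperty.hom_ext _ hc, hc'⟩
  et3_op _ _ _ _ _ _ f g δ f' g' δ' hδ hδ' b c hbc := by
    obtain ⟨a, ha, ha'⟩ := h.et3_op f.hom g.hom δ f'.hom g'.hom δ' hδ hδ' b.hom c.hom
      (congrArg (fun t => t.hom) hbc)
    exact ⟨ObjectProperty.homMk a, ObjectProperty.hom_ext _ ha, ha'⟩
  et4 _ _ _ D F f f' δ g g' δ' hδ hδ' := by
    obtain ⟨E, h', d, e, δ'', h1, h2, h3, h4, h5, h6⟩ :=
      h.et4 f.hom f'.hom δ g.hom g'.hom δ' hδ hδ'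
    exact ⟨⟨E, hP _ _ _ h4 D.property F.property⟩, ObjectProperty.homMk h',
      ObjectProperty.homMk d, ObjectProperty.homMk e, δ'', h1, ObjectProperty.hom_ext _ h2,
      ObjectProperty.hom_ext _ h3, h4, h5, h6⟩
  et4_op _ _ _ D F f' f δ g' g δ' hδ hδ' := by
    obtain ⟨E, d, e, h', δ'', h1, h2, h3, h4, h5, h6⟩ :=
      h.et4_op f'.hom f.hom δ g'.hom g.hom δ' hδ hδ'
    exact ⟨⟨E, hP _ _ _ h4 D.property F.property⟩, ObjectProperty.homMk d,
      ObjectProperty.homMk e, ObjectProperty.homMk h', δ'', h1, ObjectProperty.hom_ext _ h2,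
      ObjectProperty.hom_ext _ h3, h4, h5, h6⟩

lemma IsExtriangulated.restrict_rightPerp (h : S.IsExtriangulated) (𝒳 : ObjectProperty C) :
    (S.restrict (S.rightPerp 𝒳)).IsExtriangulated :=
  h.restrict _
    (by
      obtain ⟨Z, hZ⟩ := h.hasZeroObject
      exact ⟨Z, fun _ _ => h.ext_eq_zero_of_isZero_right hZ, hZ⟩)
    (fun _ _ _ _ _ _ hδ hA hX _ h𝒳 => h.ext_middle_right_eq_zero hδ (hA h𝒳) (hX h𝒳))

/-! ### Conflations built from approximations -/

/-- Every `Y` is the target of a deflation `(x, p) : X ⊕ P ⟶ Y`, with `x` a right approximation and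
`P` projective; its cocone lies in `𝒳^{⊥₁}`, since every morphism from `𝒳` to `Y` lifts. -/
lemma IsFrobenius.exists_deflation_rightPerp (h : S.IsFrobenius) {𝒳 : ObjectProperty C}
    (hrigid : S.IsRigid 𝒳) (hff : FunctoriallyFinite 𝒳) (Y : C) :
    ∃ (X P : C) (b : BinaryBicone X P) (Z : C) (f : Z ⟶ b.pt) (g : b.pt ⟶ Y) (δ : S.Ext Y Z),
      𝒳 X ∧ S.IsProj P ∧ Nonempty b.IsBilimit ∧ S.rightPerp 𝒳 Z ∧ S.Realizes f g δ := by
  have := h.hasBinaryBiproducts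
  obtain ⟨X, x, hX, hx⟩ := hff.1 Y
  obtain ⟨P, p, hP, hp⟩ := h.enough_proj Y
  obtain ⟨Z, f, δ, hδ⟩ := h.deflation_desc x hp
  refine ⟨X, P, BinaryBiproduct.bicone X P, Z, f, biprod.desc x p, δ, hX, hP,
    ⟨BinaryBiproduct.isBilimit X P⟩, fun X' hX' ε => ?_, hδ⟩
  have hB := h.ext_biprod_right_eq_zero (Z := X') (BinaryBiproduct.bicone X P)
    ⟨BinaryBiproduct.isBilimit X P⟩ (hrigid X' hX' hX)
    (h.ext_injective_eq_zero ((h.proj_iff_inj P).1 hP))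
  obtain ⟨c, rfl⟩ := h.exists_pull_eq hδ ε (hB _)
  obtain ⟨t, rfl⟩ := hx hX' c
  have : t ≫ x = (t ≫ biprod.inl) ≫ biprod.desc x p := by simp
  rw [this, pull_comp_apply, h.pull_deflation_eq_zero hδ, map_zero]

/-- Every `Y` is the source of an inflation `(x, i) : Y ⟶ X ⊕ I`, with `x` a left approximation and
`I` injective; its cone lies in `^{⊥₁}𝒳`. -/
lemma IsFrobenius.exists_inflation_leftPerp (h : S.IsFrobenius) {𝒳 : ObjectProperty C}
    (hrigid : S.IsRigid 𝒳) (hff : FunctoriallyFinite 𝒳) (Y : C) :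
    ∃ (X I : C) (b : BinaryBicone X I) (Z : C) (f : Y ⟶ b.pt) (g : b.pt ⟶ Z) (δ : S.Ext Z Y),
      𝒳 X ∧ S.IsInj I ∧ Nonempty b.IsBilimit ∧ S.leftPerp 𝒳 Z ∧ S.Realizes f g δ := by
  have := h.hasBinaryBiproducts
  obtain ⟨X, x, hX, hx⟩ := hff.2 Y
  obtain ⟨I, i, hI, hi⟩ := h.enough_inj Y
  obtain ⟨Z, g, δ, hδ⟩ := h.inflation_lift x hi
  refine ⟨X, I, BinaryBiproduct.bicone X I, Z, biprod.lift x i, g, δ, hX, hI,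
    ⟨BinaryBiproduct.isBilimit X I⟩, fun X' hX' ε => ?_, hδ⟩
  have hB := h.ext_biprod_left_eq_zero (Z := X') (BinaryBiproduct.bicone X I)
    ⟨BinaryBiproduct.isBilimit X I⟩ (hrigid X hX hX')
    (h.ext_proj_eq_zero ((h.proj_iff_inj I).2 hI))
  obtain ⟨a, rfl⟩ := h.exists_push_eq hδ ε (hB _)
  obtain ⟨t, rfl⟩ := hx hX' a
  have : x ≫ t = biprod.lift x i ≫ biprod.fst ≫ t := by simp
  rw [this, push_comp_apply, h.push_inflation_eq_zero hδ, map_zero]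

/-- `A` is the source of a conflation `A ⟶ D ⟶ X` with `X ∈ 𝒳` whose class generates all `𝔼(X', A)`,
`X' ∈ 𝒳`, so that `D ∈ 𝒳^{⊥₁}`; then `A ⟶ D` is a left `𝒳^{⊥₁}`-approximation. -/
lemma IsFrobenius.exists_isLeftApprox_rightPerp (h : S.IsFrobenius) {𝒳 : ObjectProperty C}
    (hrigid : S.IsRigid 𝒳) (hff : FunctoriallyFinite 𝒳) (A : C) :
    ∃ (D : C) (f : A ⟶ D), IsLeftApprox (S.rightPerp 𝒳) f := by
  obtain ⟨I, i, hI, W, p, δ, hδ⟩ := h.enough_inj A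
  obtain ⟨X, x, hX, hx⟩ := hff.1 W
  obtain ⟨D, f, g, hfg⟩ := h.exists_realizes (S.pull x δ)
  refine ⟨D, f, fun X' hX' ε => ?_, fun D' hD' a => h.factor_of_push_eq_zero hfg a (hD' hX _)⟩
  obtain ⟨ε, rfl⟩ := h.exists_push_infl_eq hfg ε (hrigid X' hX' hX _)
  obtain ⟨c, rfl⟩ := h.exists_pull_eq hδ ε (h.ext_injective_eq_zero hI _)
  obtain ⟨t, rfl⟩ := hx hX' c
  rw [pull_comp_apply, push_pull_apply, h.push_inflation_eq_zero hfg, map_zero]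

/-- The dual of `exists_isLeftApprox_rightPerp`. -/
lemma IsFrobenius.exists_isRightApprox_leftPerp (h : S.IsFrobenius) {𝒳 : ObjectProperty C}
    (hrigid : S.IsRigid 𝒳) (hff : FunctoriallyFinite 𝒳) (A : C) :
    ∃ (D : C) (g : D ⟶ A), IsRightApprox (S.leftPerp 𝒳) g := by
  obtain ⟨P, p, hP, W, i, δ, hδ⟩ := h.enough_proj A
  obtain ⟨X, x, hX, hx⟩ := hff.2 W
  obtain ⟨D, f, g, hfg⟩ := h.exists_realizes (S.push x δ)
  refine ⟨D, g, fun X' hX' ε => ?_, fun D' hD' c => h.factor_of_pull_eq_zero hfg c (hD' hX _)⟩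
  obtain ⟨ε, rfl⟩ := h.exists_pull_defl_eq hfg ε (hrigid X hX hX' _)
  obtain ⟨a, rfl⟩ := h.exists_push_eq hδ ε (h.ext_proj_eq_zero hP _)
  obtain ⟨t, rfl⟩ := hx hX' a
  rw [push_comp_apply, ← push_pull_apply, h.pull_deflation_eq_zero hfg, map_zero]

lemma IsFrobenius.functoriallyFinite_rightPerp (h : S.IsFrobenius) (hE : S.HasExtDuality)
    {𝒳 : ObjectProperty C} (hrigid : S.IsRigid 𝒳) (hff : FunctoriallyFinite 𝒳) :
    FunctoriallyFinite (S.rightPerp 𝒳) :=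
  ⟨by
    rw [hE.rightPerp_eq_leftPerp]
    exact h.exists_isRightApprox_leftPerp hrigid hff,
    h.exists_isLeftApprox_rightPerp hrigid hff⟩

/-! ### The Frobenius structure on `𝒳^{⊥₁}` -/

lemma IsExtriangulated.isProj_restrict_iff (h : S.IsExtriangulated) {𝒳 : ObjectProperty C} {Y : C}
    (hY : S.rightPerp 𝒳 Y) : (S.restrict (S.rightPerp 𝒳)).IsProj ⟨Y, hY⟩ ↔
      ∀ ⦃D : C⦄, S.rightPerp 𝒳 D → ∀ δ : S.Ext Y D, δ = 0 :=
  ((h.restrict_rightPerp 𝒳).isProj_iff _).trans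
    ⟨fun H D hD => H ⟨D, hD⟩, fun H D => H D.property⟩

lemma IsExtriangulated.isInj_restrict_iff (h : S.IsExtriangulated) {𝒳 : ObjectProperty C} {Y : C}
    (hY : S.rightPerp 𝒳 Y) : (S.restrict (S.rightPerp 𝒳)).IsInj ⟨Y, hY⟩ ↔
      ∀ ⦃D : C⦄, S.rightPerp 𝒳 D → ∀ δ : S.Ext D Y, δ = 0 :=
  ((h.restrict_rightPerp 𝒳).isInj_iff _).trans
    ⟨fun H D hD => H ⟨D, hD⟩, fun H D => H D.property⟩

/-- Objects of `add(𝒳, 𝒫)` lie in `𝒳^{⊥₁}` and have no extensions by objects of `𝒳^{⊥₁}`. -/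
lemma IsFrobenius.addClosure_perp (h : S.IsFrobenius) {𝒳 : ObjectProperty C}
    (hrigid : S.IsRigid 𝒳) {Y : C} (hY : AddClosure (𝒳 ⊔ S.IsProjInj) Y) :
    S.rightPerp 𝒳 Y ∧ ∀ ⦃D : C⦄, S.rightPerp 𝒳 D → ∀ δ : S.Ext Y D, δ = 0 := by
  induction hY with
  | of hX =>
    obtain hX | hX := hX
    · exact ⟨hrigid.le_rightPerp _ hX, fun D hD => hD hX⟩
    · exact ⟨fun _ _ => h.ext_injective_eq_zero hX.2, fun _ _ => h.ext_proj_eq_zero hX.1⟩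
  | zero hX =>
    exact ⟨fun _ _ => h.ext_eq_zero_of_isZero_right hX,
      fun _ _ => h.ext_eq_zero_of_isZero_left hX⟩
  | sum b hb _ _ hA hB =>
    exact ⟨fun _ hX => h.ext_biprod_right_eq_zero b hb (hA.1 hX) (hB.1 hX),
      fun _ hD => h.ext_biprod_left_eq_zero b hb (hA.2 hD) (hB.2 hD)⟩
  | summand b hb _ hA =>
    exact ⟨fun _ hX => ext_retract_right_eq_zero _ _ b.inl_fst (hA.1 hX),
      fun _ hD => ext_retract_left_eq_zero _ _ b.inl_fst (hA.2 hD)⟩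

lemma IsFrobenius.addClosure_of_bicone {𝒳 : ObjectProperty C} (h : S.IsFrobenius) {X P : C}
    (b : BinaryBicone X P) (hb : Nonempty b.IsBilimit) (hX : 𝒳 X) (hP : S.IsProj P) :
    AddClosure (𝒳 ⊔ S.IsProjInj) b.pt :=
  .sum b hb (.of (Or.inl hX)) (.of (Or.inr ⟨hP, (h.proj_iff_inj P).1 hP⟩))

lemma IsFrobenius.restrict_rightPerp (h : S.IsFrobenius) (hE : S.HasExtDuality)
    {𝒳 : ObjectProperty C} (hrigid : S.IsRigid 𝒳) (hff : FunctoriallyFinite 𝒳) :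
    (S.restrict (S.rightPerp 𝒳)).IsFrobenius where
  toIsExtriangulated := h.toIsExtriangulated.restrict_rightPerp 𝒳
  enough_proj Y := by
    obtain ⟨X, P, b, Z, f, g, δ, hX, hP, hb, hZ, hδ⟩ :=
      h.exists_deflation_rightPerp hrigid hff Y.obj
    obtain ⟨hB, hB'⟩ := h.addClosure_perp hrigid (h.addClosure_of_bicone b hb hX hP)
    exact ⟨⟨b.pt, hB⟩, ObjectProperty.homMk g, (h.isProj_restrict_iff hB).2 hB', ⟨Z, hZ⟩,
      ObjectProperty.homMk f, δ, hδ⟩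
  enough_inj Y := by
    obtain ⟨X, I, b, Z, f, g, δ, hX, hI, hb, hZ, hδ⟩ :=
      h.exists_inflation_leftPerp hrigid hff Y.obj
    obtain ⟨hB, hB'⟩ := h.addClosure_perp hrigid
      (h.addClosure_of_bicone b hb hX ((h.proj_iff_inj I).2 hI))
    rw [← hE.rightPerp_eq_leftPerp] at hZ
    exact ⟨⟨b.pt, hB⟩, ObjectProperty.homMk f,
      (h.isInj_restrict_iff hB).2 fun _ hD => hE.ext_eq_zero_symm (hB' hD), ⟨Z, hZ⟩,
      ObjectProperty.homMk g, δ, hδ⟩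
  proj_iff_inj Q := by
    rw [h.isProj_restrict_iff, h.isInj_restrict_iff]
    exact ⟨fun H _ hD => hE.ext_eq_zero_symm (H hD), fun H _ hD => hE.ext_eq_zero_symm (H hD)⟩

/-- The third term of a split conflation is a direct summand of the middle term. -/
lemma IsExtriangulated.addClosure_of_realizes_zero (h : S.IsExtriangulated)
    {P : ObjectProperty C} {A B X : C} {f : A ⟶ B} {g : B ⟶ X}
    (hfg : S.Realizes f g (0 : S.Ext X A)) (hB : AddClosure P B) : AddClosure P X := by
  have := h.hasBinaryBiproducts
  obtain ⟨e, he, he'⟩ := h.realizes_unique _ _ _ _ _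
    (h.realizes_split _ ⟨BinaryBiproduct.isBilimit A X⟩) hfg
  have hf : f ≫ e.inv = biprod.inl := by rw [← he]; simp
  have hg : e.hom ≫ g = biprod.snd := he'
  have hg' : g = e.inv ≫ biprod.snd := by rw [← hg]; simp
  refine .summand (Y := A)
    { pt := B
      fst := g
      snd := e.inv ≫ biprod.fst
      inl := biprod.inr ≫ e.hom
      inr := biprod.inl ≫ e.hom
      inl_fst := by simp [hg']
      inl_snd := by simp
      inr_fst := by simp [hg']
      inr_snd := by simp } ⟨isBinaryBilimitOfTotal _ ?_⟩ hB
  rw [← cancel_mono e.inv, ← cancel_epi e.hom]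
  ext <;> simp [hg']

lemma IsFrobenius.isProjInj_restrict_iff (h : S.IsFrobenius) (hE : S.HasExtDuality)
    {𝒳 : ObjectProperty C} (hrigid : S.IsRigid 𝒳) (hff : FunctoriallyFinite 𝒳) (Y : C) :
    (∃ hY : S.rightPerp 𝒳 Y, (S.restrict (S.rightPerp 𝒳)).IsProjInj ⟨Y, hY⟩) ↔
      AddClosure (𝒳 ⊔ S.IsProjInj) Y := by
  constructor
  · rintro ⟨hY, hP, -⟩
    rw [h.isProj_restrict_iff] at hP
    obtain ⟨X, P, b, Z, f, g, δ, hX, hP', hb, hZ, hδ⟩ := h.exists_deflation_rightPerp hrigid hff Y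
    obtain rfl := hP hZ δ
    exact h.addClosure_of_realizes_zero hδ (h.addClosure_of_bicone b hb hX hP')
  · intro hY
    obtain ⟨hY, hY'⟩ := h.addClosure_perp hrigid hY
    have hP := (h.isProj_restrict_iff hY).2 hY'
    exact ⟨hY, hP, ((h.restrict_rightPerp hE hrigid hff).proj_iff_inj _).1 hP⟩

/-! ### Cluster-tilting subcategories -/

lemma IsFrobenius.isClusterTilting_restrict_iff (h : S.IsFrobenius) (hE : S.HasExtDuality)
    {𝒳 : ObjectProperty C} (hrigid : S.IsRigid 𝒳) (hff : FunctoriallyFinite 𝒳)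
    (𝒯 : ObjectProperty C) :
    (𝒯 ≤ S.rightPerp 𝒳 ∧
        (S.restrict (S.rightPerp 𝒳)).IsClusterTilting (𝒯.inverseImage (S.rightPerp 𝒳).ι)) ↔
      (S.IsClusterTilting 𝒯 ∧ 𝒳 ≤ 𝒯) := by
  constructor
  · rintro ⟨h𝒯, hl, hr, hf⟩
    rw [leftPerp_restrict h𝒯] at hl
    rw [rightPerp_restrict h𝒯] at hr
    -- `𝔼(𝒳, 𝒯) = 0` since `𝒯 ≤ 𝒳^{⊥₁}`, so `𝒳` lies in the left orthogonal of `𝒯` in `𝒳^{⊥₁}`.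
    have h𝒳 : 𝒳 ≤ 𝒯 := fun X hX => by
      have : (S.leftPerp 𝒯).inverseImage (S.rightPerp 𝒳).ι ⟨X, hrigid.le_rightPerp X hX⟩ :=
        fun T hT => h𝒯 T hT hX
      rwa [hl] at this
    have hle : S.rightPerp 𝒯 ≤ S.rightPerp 𝒳 := rightPerp_anti h𝒳
    exact ⟨⟨inverseImage_ι_inj (hE.rightPerp_eq_leftPerp 𝒯 ▸ hle) h𝒯 hl,
      inverseImage_ι_inj h𝒯 hle hr,
      .of_inverseImage_ι h𝒯 (h.functoriallyFinite_rightPerp hE hrigid hff) hf⟩, h𝒳⟩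
  · rintro ⟨⟨hl, hr, hf⟩, h𝒳⟩
    have h𝒯 : 𝒯 ≤ S.rightPerp 𝒳 := hr.le.trans (rightPerp_anti h𝒳)
    refine ⟨h𝒯, ?_, ?_, hf.inverseImage_ι h𝒯⟩
    · rw [leftPerp_restrict h𝒯, hl]
    · rw [rightPerp_restrict h𝒯, ← hr]

end ExtriData

end Extri

theorem theoremt {K : Type k} [Field K] {C : Type u} [Category.{v} C] [Preadditive C] [Linear K C]
    (S : Extri.ExtriData.{w} K C) (hS : S.IsStablyTwoCYFrobenius)
    (𝒳 : ObjectProperty C) (hrigid : S.IsRigid 𝒳) (hff : Extri.FunctoriallyFinite 𝒳) :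
    (S.restrict (S.rightPerp 𝒳)).IsStablyTwoCYFrobenius ∧
    Extri.FunctoriallyFinite (S.rightPerp 𝒳) ∧
    (∀ Y : C,
      (∃ hY : S.rightPerp 𝒳 Y, (S.restrict (S.rightPerp 𝒳)).IsProjInj ⟨Y, hY⟩) ↔
        Extri.AddClosure (𝒳 ⊔ S.IsProjInj) Y) ∧
    (Extri.WeaklyIdempotentComplete C →
      Extri.WeaklyIdempotentComplete (S.rightPerp 𝒳).FullSubcategory) ∧
    (∀ 𝒯 : ObjectProperty C,
      (𝒯 ≤ S.rightPerp 𝒳 ∧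
        (S.restrict (S.rightPerp 𝒳)).IsClusterTilting (𝒯.inverseImage (S.rightPerp 𝒳).ι)) ↔
      (S.IsClusterTilting 𝒯 ∧ 𝒳 ≤ 𝒯)) := by
  obtain ⟨h, hE⟩ := Extri.ExtriData.isStablyTwoCYFrobenius_iff.1 hS
  exact ⟨Extri.ExtriData.isStablyTwoCYFrobenius_iff.2
      ⟨h.restrict_rightPerp hE hrigid hff, hE.restrict _⟩,
    h.functoriallyFinite_rightPerp hE hrigid hff,
    h.isProjInj_restrict_iff hE hrigid hff,
    fun hC => hC.fullSubcategory _ fun _ _ i r hir hY _ hX =>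
      Extri.ExtriData.ext_retract_right_eq_zero i r hir (hY hX),
    h.isClusterTilting_restrict_iff hE hrigid hff⟩
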